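/- Let $\alpha=(\alpha_n)_{n\in\mathbb N_0}$ be an increasing (i.e. non-decreasing) sequence of positive real numbers with $\alpha_n\to\infty$ which is stable, i.e. $\sup_n \alpha_{2n}/\alpha_n<\infty$. Let $$\Lambda_0(\alpha)=\Big\{x\in\mathbb C^{\mathbb N_0}:\ \|x\|_k=\sum_{n}e^{-\alpha_n/k}|x_n|<\infty\ \text{ for all }k\ge 1\Big\},\qquad \Lambda_\infty(\alpha)=\Big\{x\in\mathbb C^{\mathbb N_0}:\ \|x\|_k=\sum_{n}e^{k\alpha_n}|x_n|<\infty\ \text{ for all }k\ge 0\Big\}$$ be the power series spaces of finite and of infinite type, with the Fréchet space topologies given by these norms. For a complex locally convex space $X$ let $\mathcal U_0(X)$ be the set of absolutely convex $0$-neighbourhoods, and for $V,U\subseteq X$, $n\in\mathbb N_0$ let $\delta_n(V,U)=\inf\{\delta>0: V\subseteq\delta U+L$ for some subspace $L\subseteq X$ with $\dim L\le n\}\in[0,\infty]$. Let $\Delta(X)$ be the set of all $\xi\in\mathbb R^{\mathbb N_0}$ such that for every $U\in\mathcal U_0(X)$ there is $V\in\mathcal U_0(X)$ with $\xi_n\delta_n(V,U)\to0$.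 A bounded set $B\subseteq X$ is called prominent if $\Delta(X)=\{\xi\in\mathbb R^{\mathbb N_0}:\xi_n\delta_n(B,U)\to0\text{ for all }U\in\mathcal U_0(X)\}$. A Fréchet space $X$ with an increasing fundamental sequence of seminorms $\|\cdot\|_k$ and dual norms $\|\varphi\|_k^*=\sup\{|\varphi(x)|:\|x\|_k\le1\}\in[0,\infty]$ satisfies $(\overline\Omega)$ if for every $k$ there is $\ell\ge k$ such that for every $m\ge\ell$ there is $C>0$ with $(\|\varphi\|_\ell^*)^2\le C\|\varphi\|_k^*\|\varphi\|_m^*$ for all $\varphi\in X'$ (this does not depend on the choice of the fundamental sequence). Then: 1. $\Lambda_0(\alpha)\times\Lambda_\infty(\alpha)$ has a prominent bounded set; 2. $\Lambda_0(\alpha)\times\Lambda_\infty(\alpha)$ does not satisfy $(\overline\Omega)$; 3. $\{0\}\times\Lambda_\infty(\alpha)$ is a complemented subspace of $\Lambda_0(\alpha)\times\Lambda_\infty(\alpha)$ which has no prominent bounded set. So having a prominent bounded set is not inherited by complemented subspaces. -/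

import Mathlib

open Filter Topology
open scoped Pointwise ENNReal

noncomputable section

/-- The `n`-th Kolmogorov width `δ_n(V, U)`: the infimum, taken in `[0, ∞]`, of all real `δ > 0`
such that `V ⊆ δ U + L` for some linear subspace `L` of dimension at most `n`
(so it is `∞` if there is no such `δ`). -/
def kolmogorovWidth {X : Type*} [AddCommGroup X] [Module ℂ X] (n : ℕ) (V U : Set X) : ℝ≥0∞ :=
  sInf {d : ℝ≥0∞ | ∃ δ : ℝ, 0 < δ ∧ d = ENNReal.ofReal δ ∧
    ∃ L : Submodule ℂ X, Module.rank ℂ L ≤ n ∧ V ⊆ (δ : ℂ) • U + (L : Set X)}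

open scoped ComplexOrder in
/-- The absolutely convex neighbourhoods of `0`. -/
def absConvexNhds (X : Type*) [AddCommGroup X] [Module ℂ X] [TopologicalSpace X] : Set (Set X) :=
  {U | AbsConvex ℂ U ∧ U ∈ 𝓝 (0 : X)}

/-- The diametral dimension `Δ(X)`. -/
def diametralDimension (X : Type*) [AddCommGroup X] [Module ℂ X] [TopologicalSpace X] :
    Set (ℕ → ℝ) :=
  {ξ | ∀ U ∈ absConvexNhds X, ∃ V ∈ absConvexNhds X,
    Tendsto (fun n => ‖ξ n‖ₑ * kolmogorovWidth n V U) atTop (𝓝 0)}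

/-- A bounded set `B` is prominent if
`Δ(X) = {ξ : ξ_n δ_n(B, U) → 0 for every absolutely convex 0-neighbourhood U}`. -/
def IsProminent {X : Type*} [AddCommGroup X] [Module ℂ X] [TopologicalSpace X] (B : Set X) :
    Prop :=
  Bornology.IsVonNBounded ℂ B ∧
    diametralDimension X = {ξ | ∀ U ∈ absConvexNhds X,
      Tendsto (fun n => ‖ξ n‖ₑ * kolmogorovWidth n B U) atTop (𝓝 0)}

/-- `X` has a prominent bounded set. -/
def HasProminentSet (X : Type*) [AddCommGroup X] [Module ℂ X] [TopologicalSpace X] : Prop :=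
  ∃ B : Set X, IsProminent B

/-- The dual norm `‖φ‖* = sup {|φ(x)| : p(x) ≤ 1}`, with values in `[0, ∞]`. -/
def dualNorm {X : Type*} [AddCommGroup X] [Module ℂ X] [TopologicalSpace X]
    (p : Seminorm ℂ X) (φ : X →L[ℂ] ℂ) : ℝ≥0∞ :=
  ⨆ (x : X) (_ : p x ≤ 1), ‖φ x‖ₑ

/-- An increasing sequence of seminorms which defines the topology of `X`. -/
def IsFundamentalSequence {X : Type*} [AddCommGroup X] [Module ℂ X] [TopologicalSpace X]
    (p : ℕ → Seminorm ℂ X) : Prop :=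
  Monotone p ∧ WithSeminorms (𝕜 := ℂ) p

/-- Condition `(Ω̄)`, for spaces whose topology is given by a fundamental sequence of seminorms.
The inequality below holds for one fundamental sequence if and only if it holds for every one. -/
def SatisfiesOmegaBar (X : Type*) [AddCommGroup X] [Module ℂ X] [TopologicalSpace X] : Prop :=
  ∃ p : ℕ → Seminorm ℂ X, IsFundamentalSequence p ∧
    ∀ k, ∃ l ≥ k, ∀ m ≥ l, ∃ C : ℝ, 0 < C ∧ ∀ φ : X →L[ℂ] ℂ,
      dualNorm (p l) φ ^ 2 ≤ ENNReal.ofReal C * dualNorm (p k) φ * dualNorm (p m) φ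

/-- A Köthe matrix: positive weights `a_k(n)`, increasing in `k`. -/
structure KotheMatrix where
  weight : ℕ → ℕ → ℝ
  weight_pos : ∀ k n, 0 < weight k n
  weight_le_succ : ∀ k n, weight k n ≤ weight (k + 1) n

namespace KotheMatrix

variable (A : KotheMatrix)

/-- The vector space underlying `λ₁(A)`. -/
def submodule : Submodule ℂ (ℕ → ℂ) where
  carrier := {x | ∀ k, Summable fun n => A.weight k n * ‖x n‖}
  zero_mem' := fun k => by simp
  add_mem' := fun {x y} hx hy k => by
    refine Summable.of_nonneg_of_le
      (fun n => mul_nonneg (A.weight_pos k n).le (norm_nonneg _)) (fun n => ?_)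
      ((hx k).add (hy k))
    rw [← mul_add]
    exact mul_le_mul_of_nonneg_left (norm_add_le _ _) (A.weight_pos k n).le
  smul_mem' := fun c x hx k => by
    refine ((hx k).mul_left ‖c‖).congr fun n => ?_
    simp only [Pi.smul_apply, norm_smul]
    ring

/-- The Köthe space `λ₁(A)`. It is a separate type, so that it does not carry the topology of
pointwise convergence. -/
def Space : Type := A.submodule

instance : AddCommGroup A.Space := inferInstanceAs (AddCommGroup A.submodule)

instance : Module ℂ A.Space := inferInstanceAs (Module ℂ A.submodule)

variable {A} in
/-- The `n`-th coordinate of an element of `λ₁(A)`. -/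
def coord (x : A.Space) (n : ℕ) : ℂ := x.1 n

variable {A} in
theorem summable_coord (x : A.Space) (k : ℕ) : Summable fun n => A.weight k n * ‖coord x n‖ :=
  x.2 k

/-- The seminorm `‖x‖_k = ∑_n a_k(n) |x_n|` on `λ₁(A)`. -/
def seminorm (k : ℕ) : Seminorm ℂ A.Space :=
  Seminorm.of (fun x => ∑' n, A.weight k n * ‖coord x n‖)
    (fun x y => by
      rw [← (summable_coord x k).tsum_add (summable_coord y k)]
      refine Summable.tsum_le_tsum (fun n => ?_) (summable_coord (x + y) k)
        ((summable_coord x k).add (summable_coord y k))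
      rw [← mul_add]
      exact mul_le_mul_of_nonneg_left (norm_add_le _ _) (A.weight_pos k n).le)
    (fun c x => by
      rw [← tsum_mul_left]
      refine tsum_congr fun n => ?_
      have h : coord (c • x) n = c * coord x n := rfl
      rw [h, norm_mul]
      ring)

theorem seminorm_apply (k : ℕ) (x : A.Space) :
    A.seminorm k x = ∑' n, A.weight k n * ‖coord x n‖ := rfl

/-- `λ₁(A)` carries the locally convex topology given by the seminorms `‖·‖_k`. -/
instance : TopologicalSpace A.Space :=
  SeminormFamily.moduleFilterBasis (𝕜 := ℂ) (fun k => A.seminorm k) |>.topology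

theorem isFundamentalSequence_seminorm : IsFundamentalSequence A.seminorm :=
  ⟨monotone_nat_of_le_succ fun k x =>
    Summable.tsum_le_tsum
      (fun n => mul_le_mul_of_nonneg_right (A.weight_le_succ k n) (norm_nonneg _))
      (summable_coord x k) (summable_coord x (k + 1)), ⟨rfl⟩⟩

instance : IsTopologicalAddGroup A.Space := A.isFundamentalSequence_seminorm.2.topologicalAddGroup

instance : ContinuousSMul ℂ A.Space := A.isFundamentalSequence_seminorm.2.continuousSMul

end KotheMatrix

/-- The matrix `exp(-α_n / k)`, `k ≥ 1`, of the power series space of finite type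
(the index `k` is shifted by one). -/
def finiteTypeMatrix (α : ℕ → ℝ) (hα : ∀ n, 0 < α n) : KotheMatrix where
  weight k n := Real.exp (-α n / ((k : ℝ) + 1))
  weight_pos _ _ := Real.exp_pos _
  weight_le_succ k n := by
    rw [Real.exp_le_exp, neg_div, neg_div, neg_le_neg_iff]
    exact div_le_div_of_nonneg_left (hα n).le (by positivity) (by push_cast; linarith)

/-- The matrix `exp(k α_n)`, `k ≥ 0`, of the power series space of infinite type. -/
def infiniteTypeMatrix (α : ℕ → ℝ) (hα : ∀ n, 0 < α n) : KotheMatrix where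
  weight k n := Real.exp ((k : ℝ) * α n)
  weight_pos _ _ := Real.exp_pos _
  weight_le_succ k n := by
    rw [Real.exp_le_exp]
    exact mul_le_mul_of_nonneg_right (by push_cast; linarith) (hα n).le

/-- The power series space of finite type `Λ₀(α)`. -/
abbrev PowerSeriesSpaceFinite (α : ℕ → ℝ) (hα : ∀ n, 0 < α n) : Type :=
  (finiteTypeMatrix α hα).Space

/-- The power series space of infinite type `Λ_∞(α)`. -/
abbrev PowerSeriesSpaceInfinite (α : ℕ → ℝ) (hα : ∀ n, 0 < α n) : Type :=
  (infiniteTypeMatrix α hα).Space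

/-- `α` is stable if `α_{2n} / α_n` is bounded. -/
def IsStableSequence (α : ℕ → ℝ) : Prop :=
  BddAbove (Set.range fun n => α (2 * n) / α n)

/-- The maxima of the `k`-th seminorms of two spaces form a fundamental sequence of the product. -/
theorem IsFundamentalSequence.prod {X Y : Type*} [AddCommGroup X] [Module ℂ X]
    [TopologicalSpace X] [AddCommGroup Y] [Module ℂ Y] [TopologicalSpace Y]
    {p : ℕ → Seminorm ℂ X} {q : ℕ → Seminorm ℂ Y}
    (hp : IsFundamentalSequence p) (hq : IsFundamentalSequence q) :
    IsFundamentalSequence fun k =>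
      (p k).comp (LinearMap.fst ℂ X Y) ⊔ (q k).comp (LinearMap.snd ℂ X Y) := by
  have := hp.2.topologicalAddGroup
  have := hq.2.topologicalAddGroup
  refine ⟨fun k l h z => ?_, ?_⟩
  · exact max_le_max (hp.1 h z.1) (hq.1 h z.2)
  · rw [SeminormFamily.withSeminorms_iff_nhds_eq_iInf]
    have key : ∀ k, comap (⇑((p k).comp (LinearMap.fst ℂ X Y) ⊔ (q k).comp (LinearMap.snd ℂ X Y)))
        (𝓝 (0 : ℝ)) = comap Prod.fst (comap (p k) (𝓝 0)) ⊓ comap Prod.snd (comap (q k) (𝓝 0)) := by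
      intro k
      simp only [comap_comap]
      apply le_antisymm
      · refine le_inf ?_ ?_ <;> rw [← tendsto_iff_comap]
        · exact squeeze_zero (fun z => apply_nonneg _ _) (fun z => le_max_left _ _) tendsto_comap
        · exact squeeze_zero (fun z => apply_nonneg _ _) (fun z => le_max_right _ _) tendsto_comap
      · rw [← tendsto_iff_comap]
        have h1 : Tendsto (p k ∘ Prod.fst) (comap (p k ∘ (Prod.fst : X × Y → X)) (𝓝 0) ⊓
            comap (q k ∘ (Prod.snd : X × Y → Y)) (𝓝 0)) (𝓝 0) := tendsto_comap.mono_left inf_le_left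
        have h2 : Tendsto (q k ∘ Prod.snd) (comap (p k ∘ (Prod.fst : X × Y → X)) (𝓝 0) ⊓
            comap (q k ∘ (Prod.snd : X × Y → Y)) (𝓝 0)) (𝓝 0) :=
          tendsto_comap.mono_left inf_le_right
        have h3 := h1.max h2
        rw [max_self] at h3
        exact h3
    simp only [key, iInf_inf_eq, ← comap_iInf]
    rw [← (SeminormFamily.withSeminorms_iff_nhds_eq_iInf p).1 hp.2,
      ← (SeminormFamily.withSeminorms_iff_nhds_eq_iInf q).1 hq.2, Prod.zero_eq_mk, nhds_prod_eq]
    rfl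

end

/-!
The diagonal structure of the spaces makes their Kolmogorov widths explicit: cutting off the first
`n` coordinates bounds them from above (`kolmogorovWidth_le_of_seminorm`), and the first `n + 1`
unit vectors bound them from below by an elementary duality argument (`le_kolmogorovWidth`).

For `Λ₀(α)` the closed unit ball of `ℓ¹` is bounded, and its `n`-th width with respect to the
`k`-th unit ball is at least `exp(-α_n / (k + 1))`. On the other hand, the widths of the unit balls
of `Λ₀(α) × Λ_∞(α)` among each other are at most `exp(-ε α_⌊n/2⌋)`, since half of the dimension may
be spent on each factor and the factor of infinite type has the faster decay. By stability
`α_⌊n/2⌋` is comparable with `α_n`, so every sequence absorbed by the widths of the `ℓ¹`-ball is in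
the diametral dimension of the product, and the ball is prominent (`isProminent_l1BallProdZero`).

In `Λ_∞(α)` the widths `δ_n(B, U)` of a bounded set `B` are `O(exp(-m α_n))` for every `m`. A
diagonal argument produces a sequence which grows faster than each `exp(m α_n)`, hence is not in
the diametral dimension, but which is still absorbed by the widths of `B`
(`not_hasProminentSet_infinite`). Prominence of bounded sets is invariant under isomorphisms
(`HasProminentSet.of_continuousLinearEquiv`), so `{0} × Λ_∞(α)` has no prominent bounded set.

Condition `(Ω̄)` already fails on the coordinate functionals of the factor of infinite type, whose
dual norms are `exp(-k α_j)` (`not_satisfiesOmegaBar_prod`).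
-/

/-! ### Kolmogorov widths -/

section Width

variable {X Y : Type} [AddCommGroup X] [Module ℂ X] [AddCommGroup Y] [Module ℂ Y]

theorem kolmogorovWidth_le_of_subset {n : ℕ} {V U : Set X} {δ : ℝ} (hδ : 0 < δ)
    (L : Submodule ℂ X) (hL : Module.rank ℂ L ≤ n) (h : V ⊆ (δ : ℂ) • U + (L : Set X)) :
    kolmogorovWidth n V U ≤ ENNReal.ofReal δ :=
  sInf_le ⟨δ, hδ, rfl, L, hL, h⟩

theorem kolmogorovWidth_le_of_seminorm {n : ℕ} {V U : Set X} (q : Seminorm ℂ X) {r δ : ℝ}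
    (hδ : 0 < δ) (hU : q.closedBall 0 r ⊆ U) (L : Submodule ℂ X)
    (hL : Module.rank ℂ L ≤ n) (h : ∀ x ∈ V, ∃ l ∈ L, q (x - l) ≤ δ * r) :
    kolmogorovWidth n V U ≤ ENNReal.ofReal δ := by
  refine kolmogorovWidth_le_of_subset hδ L hL fun x hx => ?_
  obtain ⟨l, hl, hq⟩ := h x hx
  have hδ' : (δ : ℂ) ≠ 0 := by exact_mod_cast hδ.ne'
  refine Set.mem_add.2 ⟨x - l, ?_, l, hl, by abel⟩
  rw [Set.mem_smul_set_iff_inv_smul_mem₀ hδ']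
  apply hU
  rw [Seminorm.mem_closedBall_zero, map_smul_eq_mul, norm_inv, Complex.norm_real,
    Real.norm_of_nonneg hδ.le, inv_mul_le_iff₀ hδ]
  exact hq

theorem kolmogorovWidth_le_mul_of_subset_smul {n : ℕ} {B V U : Set X} {t : ℝ} (ht : 0 < t)
    (h : B ⊆ (t : ℂ) • V) :
    kolmogorovWidth n B U ≤ ENNReal.ofReal t * kolmogorovWidth n V U := by
  have ht0 : ENNReal.ofReal t ≠ 0 := by simpa using ht
  rw [← ENNReal.div_le_iff' ht0 ENNReal.ofReal_ne_top]
  refine le_sInf ?_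
  rintro d ⟨δ, hδ, rfl, L, hL, hV⟩
  rw [ENNReal.div_le_iff' ht0 ENNReal.ofReal_ne_top, ← ENNReal.ofReal_mul ht.le]
  refine kolmogorovWidth_le_of_subset (mul_pos ht hδ) L hL fun x hx => ?_
  obtain ⟨v, hv, rfl⟩ := h hx
  obtain ⟨_, ⟨u, hu, rfl⟩, l, hl, rfl⟩ := Set.mem_add.1 (hV hv)
  refine Set.mem_add.2 ⟨_, ⟨u, hu, rfl⟩, (t : ℂ) • l, L.smul_mem _ hl, ?_⟩
  simp [mul_smul]

theorem kolmogorovWidth_image_le (f : X →ₗ[ℂ] Y) (n : ℕ) (V U : Set X) :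
    kolmogorovWidth n (f '' V) (f '' U) ≤ kolmogorovWidth n V U := by
  refine le_sInf ?_
  rintro d ⟨δ, hδ, rfl, L, hL, hV⟩
  refine kolmogorovWidth_le_of_subset hδ (L.map f) ((rank_map_le f L).trans hL) ?_
  rintro _ ⟨x, hx, rfl⟩
  obtain ⟨_, ⟨u, hu, rfl⟩, l, hl, rfl⟩ := Set.mem_add.1 (hV hx)
  refine Set.mem_add.2 ⟨_, ⟨f u, ⟨u, hu, rfl⟩, rfl⟩, f l, ⟨l, hl, rfl⟩, by simp⟩

/-- Lower bound for widths. The functionals `f j` map `U` into the unit ball of a weighted `ℓ¹`-norm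
on `ℂⁿ⁺¹`, and `V` onto a set containing multiples of the unit vectors, each of norm at least `c`.
A subspace `L` of dimension at most `n` has a proper image in `ℂⁿ⁺¹`, so a nonzero functional on
`ℂⁿ⁺¹` vanishes on it. Its dual norm is attained at a multiple of a unit vector, whence `c ≤ δ`
whenever `V ⊆ δ U + L`. -/
theorem le_kolmogorovWidth {n : ℕ} {V U : Set X} (f : Fin (n + 1) → X →ₗ[ℂ] ℂ)
    (w s : Fin (n + 1) → ℝ) (hw : ∀ j, 0 < w j) (hs : ∀ j, 0 ≤ s j) {c : ℝ}
    (hU : ∀ u ∈ U, ∑ j, w j * ‖f j u‖ ≤ 1) (b : Fin (n + 1) → X) (hb : ∀ j, b j ∈ V)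
    (hfb : ∀ i j, f i (b j) = if i = j then (s j : ℂ) else 0) (hc : ∀ j, c ≤ w j * s j) :
    ENNReal.ofReal c ≤ kolmogorovWidth n V U := by
  refine le_sInf ?_
  rintro d ⟨δ, hδ, rfl, L, hL, hV⟩
  apply ENNReal.ofReal_le_ofReal
  have hlt : L.map (LinearMap.pi f) < ⊤ := by
    rw [lt_top_iff_ne_top]
    intro htop
    have h1 := (rank_map_le (LinearMap.pi f) L).trans hL
    rw [htop, rank_top, rank_fin_fun] at h1
    have h2 : n + 1 ≤ n := by exact_mod_cast h1
    omega
  obtain ⟨φ, hφ0, hφ⟩ := Submodule.exists_le_ker_of_lt_top _ hlt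
  set a : Fin (n + 1) → ℂ := fun j => φ (Pi.single j 1) with ha
  have hφa : ∀ y, φ y = ∑ j, y j * a j := fun y => by
    conv_lhs => rw [pi_eq_sum_univ' y]
    rw [map_sum]
    refine Finset.sum_congr rfl fun j _ => ?_
    rw [map_smul, smul_eq_mul, ha]
  obtain ⟨j, hj⟩ := Finite.exists_max fun j => ‖a j‖ / w j
  have hle : ∀ i, ‖a i‖ ≤ ‖a j‖ / w j * w i := fun i => (div_le_iff₀ (hw i)).1 (hj i)
  have haj : 0 < ‖a j‖ := by
    rw [norm_pos_iff]
    intro h0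
    refine hφ0 (LinearMap.ext fun y => ?_)
    rw [hφa, LinearMap.zero_apply]
    refine Finset.sum_eq_zero fun i _ => ?_
    have := hle i
    rw [h0, norm_zero, zero_div, zero_mul, norm_le_zero_iff] at this
    rw [this, mul_zero]
  obtain ⟨_, ⟨u, hu, rfl⟩, l, hl, hul⟩ := Set.mem_add.1 (hV (hb j))
  have hl0 : φ (LinearMap.pi f l) = 0 := hφ ⟨l, hl, rfl⟩
  have h1 : φ (LinearMap.pi f (b j)) = s j * a j := by
    rw [hφa, Finset.sum_eq_single j]
    · simp [hfb]
    · intro i _ hij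
      simp [hfb, hij]
    · simp
  have h2 : φ (LinearMap.pi f (b j)) = δ * φ (LinearMap.pi f u) := by
    rw [← hul]
    simp only [map_add, hl0, map_smul, smul_eq_mul, add_zero]
  have h3 : ‖φ (LinearMap.pi f u)‖ ≤ ‖a j‖ / w j := by
    rw [hφa]
    calc ‖∑ i, LinearMap.pi f u i * a i‖ ≤ ∑ i, ‖a j‖ / w j * (w i * ‖f i u‖) := by
          refine (norm_sum_le _ _).trans (Finset.sum_le_sum fun i _ => ?_)
          rw [norm_mul, LinearMap.pi_apply, mul_comm]
          exact (mul_le_mul_of_nonneg_right (hle i) (norm_nonneg _)).trans_eq (mul_assoc _ _ _)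
      _ = ‖a j‖ / w j * ∑ i, w i * ‖f i u‖ := (Finset.mul_sum ..).symm
      _ ≤ ‖a j‖ / w j := mul_le_of_le_one_right (div_nonneg haj.le (hw j).le) (hU u hu)
  have h4 : s j * ‖a j‖ ≤ δ * (‖a j‖ / w j) := by
    have h5 := congrArg norm (h1.symm.trans h2)
    rw [norm_mul, norm_mul, Complex.norm_real, Complex.norm_real, Real.norm_of_nonneg hδ.le,
      Real.norm_of_nonneg (hs j)] at h5
    rw [h5]
    exact mul_le_mul_of_nonneg_left h3 hδ.le
  have hwj := hw j
  rw [mul_div_assoc', le_div_iff₀ (hw j)] at h4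
  have h6 : (w j * s j) * ‖a j‖ ≤ δ * ‖a j‖ := by linarith
  exact (hc j).trans (le_of_mul_le_mul_right h6 haj)

open scoped ComplexOrder in
theorem Seminorm.absConvex_closedBall_zero (q : Seminorm ℂ X) (r : ℝ) :
    AbsConvex ℂ (q.closedBall 0 r) := by
  refine ⟨q.balanced_closedBall_zero r, fun x hx y hy a b ha hb hab => ?_⟩
  rw [Seminorm.mem_closedBall_zero] at *
  have hab' : ‖a‖ + ‖b‖ = 1 := by
    have h := congrArg Complex.re hab
    rwa [Complex.add_re, Complex.one_re, ← Complex.norm_of_nonneg' ha,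
      ← Complex.norm_of_nonneg' hb, Complex.ofReal_re, Complex.ofReal_re] at h
  calc q (a • x + b • y) ≤ ‖a‖ * q x + ‖b‖ * q y := by
        refine (map_add_le_add q _ _).trans_eq ?_
        rw [map_smul_eq_mul, map_smul_eq_mul]
    _ ≤ ‖a‖ * r + ‖b‖ * r := by gcongr
    _ = r := by rw [← add_mul, hab', one_mul]

end Width

/-! ### Neighbourhoods, the diametral dimension and prominent sets -/

section Topology

variable {X Y : Type} [AddCommGroup X] [Module ℂ X] [TopologicalSpace X]
  [AddCommGroup Y] [Module ℂ Y] [TopologicalSpace Y]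

theorem IsFundamentalSequence.closedBall_mem_absConvexNhds {p : ℕ → Seminorm ℂ X}
    (hp : IsFundamentalSequence p) (k : ℕ) {r : ℝ} (hr : 0 < r) :
    (p k).closedBall 0 r ∈ absConvexNhds X := by
  refine ⟨(p k).absConvex_closedBall_zero r, ?_⟩
  refine mem_of_superset (hp.2.hasBasis_zero_ball.mem_of_mem (i := ({k}, r)) hr) ?_
  rw [Finset.sup_singleton]
  exact (p k).ball_subset_closedBall 0 r

theorem IsFundamentalSequence.exists_closedBall_subset {p : ℕ → Seminorm ℂ X}
    (hp : IsFundamentalSequence p) {U : Set X} (hU : U ∈ 𝓝 (0 : X)) :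
    ∃ k, ∃ r : ℝ, 0 < r ∧ (p k).closedBall 0 r ⊆ U := by
  obtain ⟨⟨s, r⟩, hr, hs⟩ := hp.2.hasBasis_zero_ball.mem_iff.1 hU
  refine ⟨s.sup id, r / 2, half_pos hr, fun x hx => hs ?_⟩
  rw [Seminorm.mem_closedBall_zero] at hx
  rw [Seminorm.mem_ball_zero]
  have hle : s.sup p ≤ p (s.sup id) := Finset.sup_le fun i hi => hp.1 (Finset.le_sup (f := id) hi)
  exact ((hle x).trans hx).trans_lt (half_lt_self hr)

theorem IsFundamentalSequence.exists_le_smul {p : ℕ → Seminorm ℂ X}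
    (hp : IsFundamentalSequence p) {q : Seminorm ℂ X} (hq : Continuous q) :
    ∃ k, ∃ C : ℝ, 0 < C ∧ ∀ x, q x ≤ C * p k x := by
  obtain ⟨s, C, hC, h⟩ := Seminorm.bound_of_continuous hp.2 q hq
  have hle : s.sup p ≤ p (s.sup id) := Finset.sup_le fun i hi => hp.1 (Finset.le_sup (f := id) hi)
  refine ⟨s.sup id, C, by positivity, fun x => (h x).trans ?_⟩
  exact mul_le_mul_of_nonneg_left (hle x) C.2

theorem tendsto_enorm_mul_kolmogorovWidth_of_isVonNBounded {B V U : Set X} {ξ : ℕ → ℝ}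
    (hB : Bornology.IsVonNBounded ℂ B) (hV : V ∈ 𝓝 (0 : X))
    (h : Tendsto (fun n => ‖ξ n‖ₑ * kolmogorovWidth n V U) atTop (𝓝 0)) :
    Tendsto (fun n => ‖ξ n‖ₑ * kolmogorovWidth n B U) atTop (𝓝 0) := by
  obtain ⟨t, ht, hBV⟩ := (hB hV).exists_pos
  have hsub : B ⊆ (t : ℂ) • V := hBV t (by rw [Complex.norm_real, Real.norm_of_nonneg ht.le])
  have h' := ENNReal.Tendsto.const_mul (a := ENNReal.ofReal t) h (Or.inr ENNReal.ofReal_ne_top)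
  rw [mul_zero] at h'
  refine tendsto_of_tendsto_of_tendsto_of_le_of_le tendsto_const_nhds h' (fun n => zero_le)
    fun n => ?_
  calc ‖ξ n‖ₑ * kolmogorovWidth n B U
      ≤ ‖ξ n‖ₑ * (ENNReal.ofReal t * kolmogorovWidth n V U) := by
        gcongr
        exact kolmogorovWidth_le_mul_of_subset_smul ht hsub
    _ = ENNReal.ofReal t * (‖ξ n‖ₑ * kolmogorovWidth n V U) := by ring

/-- For a bounded set, one of the two inclusions in the definition of prominence is automatic. -/
theorem isProminent_of_subset {B : Set X} (hB : Bornology.IsVonNBounded ℂ B)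
    (h : {ξ : ℕ → ℝ | ∀ U ∈ absConvexNhds X,
      Tendsto (fun n => ‖ξ n‖ₑ * kolmogorovWidth n B U) atTop (𝓝 0)} ⊆ diametralDimension X) :
    IsProminent B := by
  refine ⟨hB, Set.Subset.antisymm (fun ξ hξ U hU => ?_) h⟩
  obtain ⟨V, hV, hVU⟩ := hξ U hU
  exact tendsto_enorm_mul_kolmogorovWidth_of_isVonNBounded hB hV.2 hVU

open scoped ComplexOrder in
theorem ContinuousLinearEquiv.image_mem_absConvexNhds (e : X ≃L[ℂ] Y) {U : Set X}
    (hU : U ∈ absConvexNhds X) : e '' U ∈ absConvexNhds Y := by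
  refine ⟨⟨?_, ?_⟩, ?_⟩
  · rintro a ha _ ⟨_, ⟨u, hu, rfl⟩, rfl⟩
    exact ⟨a • u, hU.1.1.smul_mem ha hu, map_smul e a u⟩
  · exact hU.1.2.linear_image e.toLinearEquiv.toLinearMap
  · have h := e.toHomeomorph.isOpenMap.image_mem_nhds hU.2
    simpa using h

theorem ContinuousLinearEquiv.kolmogorovWidth_image (e : X ≃L[ℂ] Y) (n : ℕ) (V U : Set X) :
    kolmogorovWidth n (e '' V) (e '' U) = kolmogorovWidth n V U := by
  refine le_antisymm (kolmogorovWidth_image_le e.toLinearEquiv.toLinearMap n V U) ?_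
  have h := kolmogorovWidth_image_le e.symm.toLinearEquiv.toLinearMap n (e '' V) (e '' U)
  have himg : ∀ S : Set X, e.symm.toLinearEquiv.toLinearMap '' (e '' S) = S :=
    fun S => e.symm_image_image S
  rwa [himg, himg] at h

theorem ContinuousLinearEquiv.diametralDimension_subset (e : X ≃L[ℂ] Y) :
    diametralDimension X ⊆ diametralDimension Y := by
  intro ξ hξ U hU
  obtain ⟨V, hV, h⟩ := hξ _ (e.symm.image_mem_absConvexNhds hU)
  refine ⟨e '' V, e.image_mem_absConvexNhds hV, ?_⟩
  simpa only [← e.kolmogorovWidth_image, e.image_symm_image] using h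

theorem HasProminentSet.of_continuousLinearEquiv (e : X ≃L[ℂ] Y) (h : HasProminentSet X) :
    HasProminentSet Y := by
  obtain ⟨B, hB, hΔ⟩ := h
  refine ⟨e '' B, isProminent_of_subset (hB.image (e : X →L[ℂ] Y)) fun ξ hξ => ?_⟩
  apply e.diametralDimension_subset
  rw [hΔ]
  intro U hU
  simpa only [e.kolmogorovWidth_image] using hξ _ (e.image_mem_absConvexNhds hU)

end Topology

/-! ### Köthe spaces -/

namespace KotheMatrix

variable (A : KotheMatrix)

/-- The `n`-th coordinate as a linear functional on `λ₁(A)`. -/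
def coordLM (n : ℕ) : A.Space →ₗ[ℂ] ℂ where
  toFun x := coord x n
  map_add' _ _ := rfl
  map_smul' _ _ := rfl

variable {A}

@[simp]
theorem coordLM_apply (n : ℕ) (x : A.Space) : A.coordLM n x = coord x n := rfl

theorem coord_sub (x y : A.Space) (n : ℕ) : coord (x - y) n = coord x n - coord y n := rfl

theorem coord_smul (c : ℂ) (x : A.Space) (n : ℕ) : coord (c • x) n = c * coord x n := rfl

theorem weight_mul_norm_coord_nonneg (x : A.Space) (k n : ℕ) : 0 ≤ A.weight k n * ‖coord x n‖ :=
  mul_nonneg (A.weight_pos k n).le (norm_nonneg _)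

theorem weight_mul_norm_coord_le_seminorm (x : A.Space) (k n : ℕ) :
    A.weight k n * ‖coord x n‖ ≤ A.seminorm k x :=
  (summable_coord x k).le_tsum n fun i _ => weight_mul_norm_coord_nonneg x k i

theorem sum_fin_le_seminorm (x : A.Space) (k n : ℕ) :
    ∑ j : Fin n, A.weight k j * ‖coord x j‖ ≤ A.seminorm k x := by
  rw [Fin.sum_univ_eq_sum_range fun j => A.weight k j * ‖coord x j‖]
  exact (summable_coord x k).sum_le_tsum _ fun i _ => weight_mul_norm_coord_nonneg x k i

theorem continuous_coord (n : ℕ) : Continuous fun x : A.Space => coord x n := by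
  have hs : Continuous (A.seminorm 0) := A.isFundamentalSequence_seminorm.2.continuous_seminorm 0
  refine continuous_of_continuousAt_zero (A.coordLM n) ?_
  have h0 : Tendsto (fun x => (A.weight 0 n)⁻¹ * A.seminorm 0 x) (𝓝 0) (𝓝 0) := by
    simpa using (hs.tendsto 0).const_mul (A.weight 0 n)⁻¹
  rw [ContinuousAt, map_zero]
  refine squeeze_zero_norm (fun x => ?_) h0
  rw [le_inv_mul_iff₀ (A.weight_pos 0 n)]
  exact weight_mul_norm_coord_le_seminorm x 0 n

variable (A) in
/-- The `j`-th unit vector of `λ₁(A)`. -/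
def unitVector (j : ℕ) : A.Space :=
  ⟨Pi.single j 1, fun k => summable_of_ne_finset_zero (s := {j}) fun n hn => by
    rw [Finset.mem_singleton] at hn
    simp [hn]⟩

theorem coord_unitVector (j n : ℕ) : coord (A.unitVector j) n = if n = j then 1 else 0 :=
  Pi.single_apply j (1 : ℂ) n

theorem seminorm_unitVector (k j : ℕ) : A.seminorm k (A.unitVector j) = A.weight k j := by
  rw [seminorm_apply, tsum_eq_single j]
  · simp [coord_unitVector]
  · intro n hn
    simp [coord_unitVector, hn]

variable (A) in
/-- The span of the first `j` unit vectors: all `x` whose coordinates vanish from the `j`-th on. -/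
def initialSubspace (j : ℕ) : Submodule ℂ A.Space :=
  ⨅ n ≥ j, LinearMap.ker (A.coordLM n)

theorem mem_initialSubspace {j : ℕ} {x : A.Space} :
    x ∈ A.initialSubspace j ↔ ∀ n ≥ j, coord x n = 0 := by
  simp [initialSubspace]

theorem rank_initialSubspace_le (j : ℕ) : Module.rank ℂ (A.initialSubspace j) ≤ j := by
  let f : A.initialSubspace j →ₗ[ℂ] (Fin j → ℂ) :=
    LinearMap.pi fun i => (A.coordLM i).comp (A.initialSubspace j).subtype
  have hf : Function.Injective f := by
    rw [← LinearMap.ker_eq_bot, LinearMap.ker_eq_bot']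
    rintro ⟨x, hx⟩ h
    ext
    refine Subtype.ext (funext fun n => ?_)
    rcases lt_or_ge n j with hn | hn
    · exact congrFun h ⟨n, hn⟩
    · exact mem_initialSubspace.1 hx n hn
  exact (LinearMap.rank_le_of_injective f hf).trans_eq (rank_fin_fun j)

/-- Cutting off the first `j` coordinates: the diagonal upper bound for the widths. -/
theorem exists_mem_initialSubspace_seminorm_sub_le {j k m : ℕ} {ρ : ℝ}
    (h : ∀ n ≥ j, A.weight k n ≤ ρ * A.weight m n) (x : A.Space) :
    ∃ l ∈ A.initialSubspace j, A.seminorm k (x - l) ≤ ρ * A.seminorm m x := by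
  let l : A.Space := ⟨fun n => if n < j then coord x n else 0, fun i =>
    summable_of_ne_finset_zero (s := Finset.range j) fun n hn => by
      rw [Finset.mem_range] at hn
      simp [hn]⟩
  have hl : ∀ n, coord l n = if n < j then coord x n else 0 := fun n => rfl
  refine ⟨l, mem_initialSubspace.2 fun n hn => by rw [hl, if_neg hn.not_gt], ?_⟩
  rw [seminorm_apply, seminorm_apply, ← tsum_mul_left]
  refine Summable.tsum_le_tsum (fun n => ?_) (summable_coord _ k) ((summable_coord x m).mul_left ρ)
  have hρ : 0 ≤ ρ := nonneg_of_mul_nonneg_left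
    ((A.weight_pos k j).le.trans (h j le_rfl)) (A.weight_pos m j)
  rw [coord_sub, hl]
  split_ifs with hn
  · rw [sub_self, norm_zero, mul_zero]
    exact mul_nonneg hρ (weight_mul_norm_coord_nonneg x m n)
  · rw [sub_zero, ← mul_assoc]
    exact mul_le_mul_of_nonneg_right (h n (not_lt.1 hn)) (norm_nonneg _)

end KotheMatrix

theorem Submodule.rank_prod_le {X Y : Type} [AddCommGroup X] [Module ℂ X] [AddCommGroup Y]
    [Module ℂ Y] (L : Submodule ℂ X) (M : Submodule ℂ Y) :
    Module.rank ℂ (L.prod M) ≤ Module.rank ℂ L + Module.rank ℂ M := by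
  have h : L.prod M = L.map (LinearMap.inl ℂ X Y) ⊔ M.map (LinearMap.inr ℂ X Y) := by
    rw [Submodule.map_inl, Submodule.map_inr, Submodule.prod_sup_prod, sup_bot_eq, bot_sup_eq]
  rw [h]
  exact (Submodule.rank_add_le_rank_add_rank _ _).trans
    (add_le_add (rank_map_le _ _) (rank_map_le _ _))

/-! ### Stable sequences -/

theorem IsStableSequence.exists_le_mul_half {α : ℕ → ℝ} (hpos : ∀ n, 0 < α n)
    (hmono : Monotone α) (h : IsStableSequence α) :
    ∃ K : ℝ, 0 < K ∧ ∀ n ≥ 2, α n ≤ K * α (n / 2) := by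
  obtain ⟨C, hC⟩ := h
  have hC' : ∀ n, α (2 * n) ≤ C * α n := fun n => (div_le_iff₀ (hpos n)).1 (hC ⟨n, rfl⟩)
  have hC0 : 0 < C := pos_of_mul_pos_left ((hpos _).trans_le (hC' 0)) (hpos 0).le
  refine ⟨C * C, mul_pos hC0 hC0, fun n hn => ?_⟩
  -- Doubling twice is needed for odd `n`; for `n ≥ 2` it suffices, as `n ≤ 4 ⌊n / 2⌋`.
  calc α n ≤ α (2 * (2 * (n / 2))) := hmono (by omega)
    _ ≤ C * α (2 * (n / 2)) := hC' _
    _ ≤ C * (C * α (n / 2)) := mul_le_mul_of_nonneg_left (hC' _) hC0.le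
    _ = C * C * α (n / 2) := (mul_assoc _ _ _).symm

/-! ### The product of the two power series spaces -/

section PowerSeries

variable {α : ℕ → ℝ} {hpos : ∀ n, 0 < α n}

theorem finiteTypeMatrix_weight (k n : ℕ) :
    (finiteTypeMatrix α hpos).weight k n = Real.exp (-α n / ((k : ℝ) + 1)) := rfl

theorem infiniteTypeMatrix_weight (k n : ℕ) :
    (infiniteTypeMatrix α hpos).weight k n = Real.exp ((k : ℝ) * α n) := rfl

variable (α hpos) in
/-- The fundamental sequence `max (‖x‖_k, ‖y‖_k)` on `Λ₀(α) × Λ_∞(α)`. -/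
noncomputable def prodSeminorm (k : ℕ) :
    Seminorm ℂ (PowerSeriesSpaceFinite α hpos × PowerSeriesSpaceInfinite α hpos) :=
  ((finiteTypeMatrix α hpos).seminorm k).comp (LinearMap.fst ℂ _ _) ⊔
    ((infiniteTypeMatrix α hpos).seminorm k).comp (LinearMap.snd ℂ _ _)

theorem prodSeminorm_apply (k : ℕ)
    (z : PowerSeriesSpaceFinite α hpos × PowerSeriesSpaceInfinite α hpos) :
    prodSeminorm α hpos k z = max ((finiteTypeMatrix α hpos).seminorm k z.1)
      ((infiniteTypeMatrix α hpos).seminorm k z.2) := rfl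

theorem isFundamentalSequence_prodSeminorm : IsFundamentalSequence (prodSeminorm α hpos) :=
  (finiteTypeMatrix α hpos).isFundamentalSequence_seminorm.prod
    (infiniteTypeMatrix α hpos).isFundamentalSequence_seminorm

variable (α hpos) in
/-- The set `B × {0}`, where `B` is the closed unit ball of `ℓ¹`, written as the intersection of
the unit balls of all the norms of `Λ₀(α)`. -/
def l1BallProdZero : Set (PowerSeriesSpaceFinite α hpos × PowerSeriesSpaceInfinite α hpos) :=
  {z | (∀ k, (finiteTypeMatrix α hpos).seminorm k z.1 ≤ 1) ∧ z.2 = 0}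

theorem isVonNBounded_l1BallProdZero : Bornology.IsVonNBounded ℂ (l1BallProdZero α hpos) := by
  rw [isFundamentalSequence_prodSeminorm.2.isVonNBounded_iff_seminorm_bounded]
  refine fun k => ⟨2, two_pos, ?_⟩
  rintro z ⟨h1, h2⟩
  rw [prodSeminorm_apply, h2, map_zero]
  exact max_lt ((h1 k).trans_lt one_lt_two) two_pos

/-- The widths of the `ℓ¹`-ball with respect to the `k`-th unit ball are at least
`exp(-α_n / (k + 1))`. -/
theorem le_kolmogorovWidth_l1BallProdZero (hmono : Monotone α) (n k : ℕ) :
    ENNReal.ofReal (Real.exp (-α n / ((k : ℝ) + 1))) ≤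
      kolmogorovWidth n (l1BallProdZero α hpos) ((prodSeminorm α hpos k).closedBall 0 1) := by
  have hk : (0 : ℝ) < (k : ℝ) + 1 := by positivity
  refine le_kolmogorovWidth
    (fun j => ((finiteTypeMatrix α hpos).coordLM j).comp (LinearMap.fst ℂ _ _))
    (fun j => (finiteTypeMatrix α hpos).weight k j) (fun _ => 1)
    (fun j => (finiteTypeMatrix α hpos).weight_pos k j) (fun _ => zero_le_one)
    (fun u hu => ?_) (fun j => ((finiteTypeMatrix α hpos).unitVector j, 0)) (fun j => ?_)
    (fun i j => ?_) (fun j => ?_)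
  · rw [Seminorm.mem_closedBall_zero, prodSeminorm_apply] at hu
    exact (KotheMatrix.sum_fin_le_seminorm u.1 k (n + 1)).trans ((le_max_left _ _).trans hu)
  · refine ⟨fun i => ?_, rfl⟩
    rw [KotheMatrix.seminorm_unitVector, finiteTypeMatrix_weight, Real.exp_le_one_iff]
    exact div_nonpos_of_nonpos_of_nonneg (neg_nonpos.2 (hpos _).le) (by positivity)
  · simp [KotheMatrix.coord_unitVector, Fin.ext_iff]
  · rw [mul_one, finiteTypeMatrix_weight, Real.exp_le_exp]
    exact div_le_div_of_nonneg_right (neg_le_neg (hmono (Nat.lt_succ_iff.1 j.2))) hk.le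

/-- Upper bound for widths in the product: half of the dimension is spent on each factor. The index
`2 k + 1` is chosen so that the exponents `1 / (k + 1)` and `1 / (2 k + 2)` of the two norms of
`Λ₀(α)` differ by `1 / (2 (k + 1))`. -/
theorem kolmogorovWidth_closedBall_prodSeminorm_le (hmono : Monotone α) (n k : ℕ) {r : ℝ}
    (hr : 0 < r) {U : Set (PowerSeriesSpaceFinite α hpos × PowerSeriesSpaceInfinite α hpos)}
    (hU : (prodSeminorm α hpos k).closedBall 0 r ⊆ U) :
    kolmogorovWidth n ((prodSeminorm α hpos (2 * k + 1)).closedBall 0 1) U ≤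
      ENNReal.ofReal (Real.exp (-α (n / 2) / (2 * ((k : ℝ) + 1))) / r) := by
  have hk : (0 : ℝ) < (k : ℝ) + 1 := by positivity
  set j := n / 2 with hj
  set ρ := Real.exp (-α j / (2 * ((k : ℝ) + 1))) with hρ
  have hρ0 : 0 < ρ := Real.exp_pos _
  refine kolmogorovWidth_le_of_seminorm (prodSeminorm α hpos k) (div_pos hρ0 hr) hU
    (((finiteTypeMatrix α hpos).initialSubspace j).prod
      ((infiniteTypeMatrix α hpos).initialSubspace j)) ?_ fun z hz => ?_
  · refine (Submodule.rank_prod_le _ _).trans ((add_le_add (KotheMatrix.rank_initialSubspace_le j)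
      (KotheMatrix.rank_initialSubspace_le j)).trans ?_)
    have h2 : j + j ≤ n := by omega
    exact_mod_cast h2
  · rw [Seminorm.mem_closedBall_zero, prodSeminorm_apply, max_le_iff] at hz
    obtain ⟨x, hx, hxz⟩ := KotheMatrix.exists_mem_initialSubspace_seminorm_sub_le
      (A := finiteTypeMatrix α hpos) (j := j) (k := k) (m := 2 * k + 1) (ρ := ρ) (fun i hi => by
        rw [finiteTypeMatrix_weight, finiteTypeMatrix_weight, hρ, ← Real.exp_add, Real.exp_le_exp]
        have h1 : -α i / ((k : ℝ) + 1) = -α i / (2 * ((k : ℝ) + 1)) +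
            -α i / (((2 * k + 1 : ℕ) : ℝ) + 1) := by
          push_cast
          field_simp
          ring
        rw [h1]
        gcongr
        exact hmono hi) z.1
    obtain ⟨y, hy, hyz⟩ := KotheMatrix.exists_mem_initialSubspace_seminorm_sub_le
      (A := infiniteTypeMatrix α hpos) (j := j) (k := k) (m := 2 * k + 1) (ρ := ρ) (fun i hi => by
        rw [infiniteTypeMatrix_weight, infiniteTypeMatrix_weight, hρ, ← Real.exp_add,
          Real.exp_le_exp]
        have h1 : α j / (2 * ((k : ℝ) + 1)) ≤ ((k : ℝ) + 1) * α i :=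
          calc α j / (2 * ((k : ℝ) + 1)) ≤ α j :=
                div_le_self (hpos j).le (by linarith [(Nat.cast_nonneg k : (0 : ℝ) ≤ k)])
            _ ≤ α i := hmono hi
            _ ≤ ((k : ℝ) + 1) * α i := le_mul_of_one_le_left (hpos i).le
                (by linarith [(Nat.cast_nonneg k : (0 : ℝ) ≤ k)])
        rw [neg_div]
        push_cast
        linarith) z.2
    refine ⟨(x, y), ⟨hx, hy⟩, ?_⟩
    rw [div_mul_cancel₀ _ hr.ne', prodSeminorm_apply]
    exact max_le (hxz.trans (mul_le_of_le_one_right hρ0.le hz.1))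
      (hyz.trans (mul_le_of_le_one_right hρ0.le hz.2))

theorem isProminent_l1BallProdZero (hmono : Monotone α) (hstable : IsStableSequence α) :
    IsProminent (l1BallProdZero α hpos) := by
  refine isProminent_of_subset isVonNBounded_l1BallProdZero fun ξ hξ U hU => ?_
  obtain ⟨k, r, hr, hkr⟩ := isFundamentalSequence_prodSeminorm.exists_closedBall_subset hU.2
  refine ⟨_, isFundamentalSequence_prodSeminorm.closedBall_mem_absConvexNhds (2 * k + 1) one_pos,
    ?_⟩
  obtain ⟨K, hK, hαK⟩ := hstable.exists_le_mul_half hpos hmono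
  have hk : (0 : ℝ) < (k : ℝ) + 1 := by positivity
  -- Stability lets a norm of higher index absorb the passage from `n` to `n / 2`.
  obtain ⟨i, hi⟩ := exists_nat_ge (K * (2 * ((k : ℝ) + 1)))
  have hlim := ENNReal.Tendsto.const_mul (a := ENNReal.ofReal r⁻¹)
    (hξ _ (isFundamentalSequence_prodSeminorm.closedBall_mem_absConvexNhds i one_pos))
    (Or.inr ENNReal.ofReal_ne_top)
  rw [mul_zero] at hlim
  refine tendsto_of_tendsto_of_tendsto_of_le_of_le' tendsto_const_nhds hlim
    (Eventually.of_forall fun n => zero_le) ?_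
  filter_upwards [eventually_ge_atTop 2] with n hn
  have hexp : Real.exp (-α (n / 2) / (2 * ((k : ℝ) + 1))) ≤ Real.exp (-α n / ((i : ℝ) + 1)) := by
    rw [Real.exp_le_exp, neg_div, neg_div, neg_le_neg_iff,
      div_le_div_iff₀ (by positivity) (by positivity)]
    calc α n * (2 * ((k : ℝ) + 1)) ≤ K * α (n / 2) * (2 * ((k : ℝ) + 1)) :=
          mul_le_mul_of_nonneg_right (hαK n hn) (by positivity)
      _ = α (n / 2) * (K * (2 * ((k : ℝ) + 1))) := by ring
      _ ≤ α (n / 2) * ((i : ℝ) + 1) :=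
          mul_le_mul_of_nonneg_left (by linarith) (hpos _).le
  calc ‖ξ n‖ₑ * kolmogorovWidth n ((prodSeminorm α hpos (2 * k + 1)).closedBall 0 1) U
      ≤ ‖ξ n‖ₑ * ENNReal.ofReal (Real.exp (-α n / ((i : ℝ) + 1)) / r) := by
        refine mul_le_mul_right
          ((kolmogorovWidth_closedBall_prodSeminorm_le hmono n k hr hkr).trans ?_) _
        exact ENNReal.ofReal_le_ofReal (div_le_div_of_nonneg_right hexp hr.le)
    _ = ENNReal.ofReal r⁻¹ * (‖ξ n‖ₑ * ENNReal.ofReal (Real.exp (-α n / ((i : ℝ) + 1)))) := by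
        rw [div_eq_inv_mul, ENNReal.ofReal_mul (inv_nonneg.2 hr.le)]
        ring
    _ ≤ _ := by
        gcongr
        exact le_kolmogorovWidth_l1BallProdZero hmono n i

/-! ### Failure of `(Ω̄)` -/

theorem dualNorm_le_mul_dualNorm {X : Type} [AddCommGroup X] [Module ℂ X] [TopologicalSpace X]
    {p q : Seminorm ℂ X} {C : ℝ} (hC : 0 < C) (h : ∀ x, p x ≤ C * q x) (φ : X →L[ℂ] ℂ) :
    dualNorm q φ ≤ ENNReal.ofReal C * dualNorm p φ := by
  refine iSup₂_le fun x hx => ?_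
  have hC' : (C : ℂ) ≠ 0 := by exact_mod_cast hC.ne'
  have hmem : p ((C : ℂ)⁻¹ • x) ≤ 1 := by
    rw [map_smul_eq_mul, norm_inv, Complex.norm_real, Real.norm_of_nonneg hC.le,
      inv_mul_le_iff₀ hC]
    exact (h x).trans (mul_le_mul_of_nonneg_left hx hC.le)
  have hφ : ‖φ x‖ₑ = ENNReal.ofReal C * ‖φ ((C : ℂ)⁻¹ • x)‖ₑ := by
    rw [← Real.enorm_of_nonneg hC.le]
    have : ‖C‖ₑ = ‖(C : ℂ)‖ₑ := by simp [enorm_eq_nnnorm]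
    rw [this, ← enorm_mul, map_smul, smul_eq_mul, mul_inv_cancel_left₀ hC']
  rw [hφ]
  gcongr
  exact le_iSup₂_of_le (f := fun (x : X) (_ : p x ≤ 1) => ‖φ x‖ₑ) _ hmem le_rfl

variable (α hpos) in
/-- The functional `(x, y) ↦ y_j` on `Λ₀(α) × Λ_∞(α)`. -/
noncomputable def sndCoordCLM (j : ℕ) :
    PowerSeriesSpaceFinite α hpos × PowerSeriesSpaceInfinite α hpos →L[ℂ] ℂ where
  toLinearMap := ((infiniteTypeMatrix α hpos).coordLM j).comp (LinearMap.snd ℂ _ _)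
  cont := (KotheMatrix.continuous_coord j).comp continuous_snd

theorem dualNorm_sndCoordCLM (k j : ℕ) :
    dualNorm (prodSeminorm α hpos k) (sndCoordCLM α hpos j) =
      ENNReal.ofReal (Real.exp (-((k : ℝ) * α j))) := by
  have happ : ∀ z, sndCoordCLM α hpos j z = KotheMatrix.coord z.2 j := fun _ => rfl
  apply le_antisymm
  · refine iSup₂_le fun z hz => ?_
    rw [prodSeminorm_apply, max_le_iff] at hz
    have h := (KotheMatrix.weight_mul_norm_coord_le_seminorm z.2 k j).trans hz.2
    rw [happ, ← ofReal_norm]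
    apply ENNReal.ofReal_le_ofReal
    rw [infiniteTypeMatrix_weight] at h
    rw [Real.exp_neg, ← one_div, le_div_iff₀ (Real.exp_pos _), mul_comm]
    exact h
  · set c : ℝ := Real.exp (-((k : ℝ) * α j)) with hc
    have hc0 : 0 < c := Real.exp_pos _
    refine le_iSup₂_of_le (0, (c : ℂ) • (infiniteTypeMatrix α hpos).unitVector j) ?_ ?_
    · rw [prodSeminorm_apply, map_zero, map_smul_eq_mul, KotheMatrix.seminorm_unitVector,
        Complex.norm_real, Real.norm_of_nonneg hc0.le, infiniteTypeMatrix_weight, hc,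
        ← Real.exp_add, neg_add_cancel, Real.exp_zero]
      exact max_le zero_le_one le_rfl
    · rw [happ, KotheMatrix.coord_smul, KotheMatrix.coord_unitVector, if_pos rfl, mul_one,
        ← ofReal_norm, Complex.norm_real, Real.norm_of_nonneg hc0.le]

/-- The dual norms of the coordinate functionals on the factor of infinite type are
`exp(-k α_j)`. For an arbitrary fundamental sequence, `(Ω̄)` would give, for some `l` and all `m`,
a bound `exp(-2 l α_j) ≤ C exp(-m α_j)`. This fails for `m = 2 l + 1`. -/
theorem not_satisfiesOmegaBar_prod (htop : Tendsto α atTop atTop) :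
    ¬ SatisfiesOmegaBar (PowerSeriesSpaceFinite α hpos × PowerSeriesSpaceInfinite α hpos) := by
  rintro ⟨p, hp, hΩ⟩
  have hq := isFundamentalSequence_prodSeminorm (α := α) (hpos := hpos)
  obtain ⟨k, C₁, hC₁, h₁⟩ := hp.exists_le_smul (hq.2.continuous_seminorm 0)
  obtain ⟨l, -, hl⟩ := hΩ k
  obtain ⟨l', C₂, hC₂, h₂⟩ := hq.exists_le_smul (hp.2.continuous_seminorm l)
  obtain ⟨m', C₃, hC₃, h₃⟩ := hp.exists_le_smul (hq.2.continuous_seminorm (2 * l' + 1))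
  obtain ⟨C, hC, hΩC⟩ := hl (max l m') (le_max_left _ _)
  have h₃' : ∀ x, prodSeminorm α hpos (2 * l' + 1) x ≤ C₃ * p (max l m') x := fun x =>
    (h₃ x).trans (mul_le_mul_of_nonneg_left (hp.1 (le_max_right l m') x) hC₃.le)
  have key : ∀ j, Real.exp (α j) ≤ C₂ ^ 2 * (C * C₁ * C₃) := fun j => by
    have e₁ := dualNorm_le_mul_dualNorm hC₁ h₁ (sndCoordCLM α hpos j)
    have e₂ := dualNorm_le_mul_dualNorm hC₂ h₂ (sndCoordCLM α hpos j)
    have e₃ := dualNorm_le_mul_dualNorm hC₃ h₃' (sndCoordCLM α hpos j)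
    rw [dualNorm_sndCoordCLM, ← ENNReal.ofReal_mul (by positivity)] at e₁ e₃
    rw [dualNorm_sndCoordCLM] at e₂
    have e₄ : ENNReal.ofReal (Real.exp (-((l' : ℝ) * α j)) ^ 2) ≤
        ENNReal.ofReal (C₂ ^ 2 * (C * (C₁ * Real.exp (-(((0 : ℕ) : ℝ) * α j))) *
          (C₃ * Real.exp (-(((2 * l' + 1 : ℕ) : ℝ) * α j))))) := by
      rw [ENNReal.ofReal_pow (Real.exp_pos _).le, ENNReal.ofReal_mul (by positivity),
        ENNReal.ofReal_mul (by positivity), ENNReal.ofReal_mul hC.le,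
        ENNReal.ofReal_pow hC₂.le]
      refine (pow_le_pow_left' e₂ 2).trans ?_
      rw [mul_pow]
      gcongr
      exact (hΩC _).trans (by gcongr)
    rw [ENNReal.ofReal_le_ofReal_iff (by positivity)] at e₄
    have e₅ : Real.exp (-(((2 * l' + 1 : ℕ) : ℝ) * α j)) =
        Real.exp (-((l' : ℝ) * α j)) ^ 2 * (Real.exp (α j))⁻¹ := by
      rw [← Real.exp_neg, ← Real.exp_nat_mul, ← Real.exp_add]
      congr 1
      push_cast
      ring
    rw [e₅, Nat.cast_zero, zero_mul, neg_zero, Real.exp_zero] at e₄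
    have hx : 0 < Real.exp (-((l' : ℝ) * α j)) ^ 2 := by positivity
    have hy := Real.exp_pos (α j)
    have e₆ : Real.exp (-((l' : ℝ) * α j)) ^ 2 * Real.exp (α j) ≤
        Real.exp (-((l' : ℝ) * α j)) ^ 2 * (C₂ ^ 2 * (C * C₁ * C₃)) := by
      refine (mul_le_mul_of_nonneg_right e₄ hy.le).trans_eq ?_
      field_simp
    exact le_of_mul_le_mul_left e₆ hx
  obtain ⟨j, hj⟩ := ((Real.tendsto_exp_atTop.comp htop).eventually_gt_atTop
    (C₂ ^ 2 * (C * C₁ * C₃))).exists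
  exact absurd (key j) (not_le.2 hj)

end PowerSeries

/-! ### The space of infinite type has no prominent bounded set -/

theorem exists_pos_summable_mul_shift (C : ℕ → ℝ) (hC : ∀ k, 0 ≤ C k) :
    ∃ c : ℕ → ℝ, (∀ m, 0 < c m) ∧ ∀ k, Summable fun m => c m * C (m + k + 1) := by
  -- For `m ≥ k` the index `m + k + 1` is at most `2 m + 1`, so that `C (m + k + 1) ≤ M m`.
  let M : ℕ → ℝ := fun m => 1 + ∑ i ∈ Finset.range (2 * m + 2), C i
  have hM : ∀ m, 0 < M m := fun m => by
    have := Finset.sum_nonneg fun i (_ : i ∈ Finset.range (2 * m + 2)) => hC i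
    simp only [M]
    linarith
  refine ⟨fun m => (1 / 2) ^ m / M m, fun m => div_pos (by positivity) (hM m), fun k => ?_⟩
  refine Summable.of_norm_bounded_eventually_nat summable_geometric_two ?_
  filter_upwards [eventually_ge_atTop k] with m hm
  have hle : C (m + k + 1) ≤ M m := by
    have := Finset.single_le_sum (fun i _ => hC i)
      (Finset.mem_range.2 (by omega : m + k + 1 < 2 * m + 2))
    simp only [M]
    linarith
  rw [Real.norm_of_nonneg (mul_nonneg (div_nonneg (by positivity) (hM m).le) (hC _)),
    div_mul_eq_mul_div, div_le_iff₀ (hM m)]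
  exact mul_le_mul_of_nonneg_left hle (by positivity)

section Infinite

variable {α : ℕ → ℝ} {hpos : ∀ n, 0 < α n}

theorem kolmogorovWidth_infinite_le (hmono : Monotone α) (n k m : ℕ) {r C : ℝ} (hr : 0 < r)
    (hC : 0 < C) {B U : Set (PowerSeriesSpaceInfinite α hpos)}
    (hB : ∀ x ∈ B, (infiniteTypeMatrix α hpos).seminorm (m + k + 1) x ≤ C)
    (hU : ((infiniteTypeMatrix α hpos).seminorm k).closedBall 0 r ⊆ U) :
    kolmogorovWidth n B U ≤
      ENNReal.ofReal (Real.exp (-(((m : ℝ) + 1) * α n)) * C / r) := by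
  refine kolmogorovWidth_le_of_seminorm ((infiniteTypeMatrix α hpos).seminorm k)
    (by positivity) hU ((infiniteTypeMatrix α hpos).initialSubspace n)
    (KotheMatrix.rank_initialSubspace_le n) fun x hx => ?_
  obtain ⟨l, hl, hxl⟩ := KotheMatrix.exists_mem_initialSubspace_seminorm_sub_le
    (A := infiniteTypeMatrix α hpos) (j := n) (k := k) (m := m + k + 1)
    (ρ := Real.exp (-(((m : ℝ) + 1) * α n))) (fun i hi => by
      rw [infiniteTypeMatrix_weight, infiniteTypeMatrix_weight, ← Real.exp_add, Real.exp_le_exp]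
      have h1 : ((m : ℝ) + 1) * α n ≤ ((m : ℝ) + 1) * α i :=
        mul_le_mul_of_nonneg_left (hmono hi) (by positivity)
      push_cast
      linarith) x
  refine ⟨l, hl, ?_⟩
  rw [div_mul_cancel₀ _ hr.ne']
  exact hxl.trans (mul_le_mul_of_nonneg_left (hB x hx) (Real.exp_pos _).le)

theorem le_kolmogorovWidth_infinite (hmono : Monotone α) (n m : ℕ) {r : ℝ} (hr : 0 < r)
    {V : Set (PowerSeriesSpaceInfinite α hpos)}
    (hV : ((infiniteTypeMatrix α hpos).seminorm m).closedBall 0 r ⊆ V) :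
    ENNReal.ofReal (r * Real.exp (-((m : ℝ) * α n))) ≤
      kolmogorovWidth n V (((infiniteTypeMatrix α hpos).seminorm 0).closedBall 0 1) := by
  set s : ℕ → ℝ := fun j => r * Real.exp (-((m : ℝ) * α j)) with hs
  have hs0 : ∀ j, 0 < s j := fun j => mul_pos hr (Real.exp_pos _)
  refine le_kolmogorovWidth (fun j => (infiniteTypeMatrix α hpos).coordLM j)
    (fun j => (infiniteTypeMatrix α hpos).weight 0 j) (fun j => s j)
    (fun j => (infiniteTypeMatrix α hpos).weight_pos 0 j) (fun j => (hs0 j).le)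
    (fun u hu => ?_) (fun j => (s j : ℂ) • (infiniteTypeMatrix α hpos).unitVector j)
    (fun j => hV ?_) (fun i j => ?_) (fun j => ?_)
  · rw [Seminorm.mem_closedBall_zero] at hu
    exact (KotheMatrix.sum_fin_le_seminorm u 0 (n + 1)).trans hu
  · rw [Seminorm.mem_closedBall_zero, map_smul_eq_mul, KotheMatrix.seminorm_unitVector,
      Complex.norm_real, Real.norm_of_nonneg (hs0 j).le, infiniteTypeMatrix_weight, hs, mul_assoc,
      ← Real.exp_add, neg_add_cancel, Real.exp_zero, mul_one]
  · rw [KotheMatrix.coordLM_apply, KotheMatrix.coord_smul, KotheMatrix.coord_unitVector]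
    simp [Fin.ext_iff]
  · rw [infiniteTypeMatrix_weight, Nat.cast_zero, zero_mul, Real.exp_zero, one_mul]
    refine mul_le_mul_of_nonneg_left (Real.exp_le_exp.2 (neg_le_neg ?_)) hr.le
    exact mul_le_mul_of_nonneg_left (hmono (Nat.lt_succ_iff.1 j.2)) (Nat.cast_nonneg m)

/-- If `‖·‖_k ≤ C k` on `B`, the widths of `B` are at most `C (m + k + 1) exp(-(m + 1) α_n)` for
every `m`. The sequence `ξ_n = ∑_{m ≤ n} c_m exp(m α_n)` with small `c_m` eventually dominates
every `c_m exp(m α_n)`, so it is not in the diametral dimension, but the widths of `B` still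
absorb it. -/
theorem not_hasProminentSet_infinite (hmono : Monotone α) (htop : Tendsto α atTop atTop) :
    ¬ HasProminentSet (PowerSeriesSpaceInfinite α hpos) := by
  rintro ⟨B, hB, hΔ⟩
  have hq := (infiniteTypeMatrix α hpos).isFundamentalSequence_seminorm
  choose C hC0 hC using hq.2.isVonNBounded_iff_seminorm_bounded.1 hB
  obtain ⟨c, hc0, hc⟩ := exists_pos_summable_mul_shift C fun k => (hC0 k).le
  set ξ : ℕ → ℝ := fun n => ∑ m ∈ Finset.range (n + 1), c m * Real.exp ((m : ℝ) * α n) with hξ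
  have hterm : ∀ m n, 0 ≤ c m * Real.exp ((m : ℝ) * α n) := fun m n =>
    mul_nonneg (hc0 m).le (Real.exp_pos _).le
  have hξ0 : ∀ n, 0 ≤ ξ n := fun n => Finset.sum_nonneg fun m _ => hterm m n
  have hmem : ξ ∈ diametralDimension (PowerSeriesSpaceInfinite α hpos) := by
    rw [hΔ]
    intro U hU
    obtain ⟨k, r, hr, hkr⟩ := hq.exists_closedBall_subset hU.2
    set S := ∑' m, c m * C (m + k + 1) with hS
    have hbound : ∀ n, ‖ξ n‖ₑ * kolmogorovWidth n B U ≤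
        ENNReal.ofReal (S / r * Real.exp (-α n)) := fun n => by
      calc ‖ξ n‖ₑ * kolmogorovWidth n B U
          = ∑ m ∈ Finset.range (n + 1),
              ENNReal.ofReal (c m * Real.exp ((m : ℝ) * α n)) * kolmogorovWidth n B U := by
            rw [Real.enorm_of_nonneg (hξ0 n), hξ,
              ENNReal.ofReal_sum_of_nonneg fun m _ => hterm m n, Finset.sum_mul]
        _ ≤ ∑ m ∈ Finset.range (n + 1),
              ENNReal.ofReal (c m * C (m + k + 1) * (Real.exp (-α n) / r)) := by
            refine Finset.sum_le_sum fun m _ => ?_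
            refine (mul_le_mul_right (kolmogorovWidth_infinite_le hmono n k m hr
              (hC0 (m + k + 1)) (fun x hx => (hC _ x hx).le) hkr) _).trans_eq ?_
            rw [← ENNReal.ofReal_mul (hterm m n)]
            congr 1
            have : Real.exp (-α n) =
                Real.exp ((m : ℝ) * α n) * Real.exp (-(((m : ℝ) + 1) * α n)) := by
              rw [← Real.exp_add]
              congr 1
              ring
            rw [this]
            ring
        _ = ENNReal.ofReal ((∑ m ∈ Finset.range (n + 1), c m * C (m + k + 1)) *
              (Real.exp (-α n) / r)) := by
            rw [Finset.sum_mul, ENNReal.ofReal_sum_of_nonneg fun m _ =>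
              mul_nonneg (mul_nonneg (hc0 m).le (hC0 _).le) (by positivity)]
        _ ≤ ENNReal.ofReal (S * (Real.exp (-α n) / r)) := by
            gcongr
            exact (hc k).sum_le_tsum _ fun m _ => mul_nonneg (hc0 m).le (hC0 _).le
        _ = ENNReal.ofReal (S / r * Real.exp (-α n)) := by
            congr 1
            ring
    have hlim : Tendsto (fun n => ENNReal.ofReal (S / r * Real.exp (-α n))) atTop (𝓝 0) := by
      have h1 : Tendsto (fun n => S / r * Real.exp (-α n)) atTop (𝓝 0) := by
        simpa using (Real.tendsto_exp_neg_atTop_nhds_zero.comp htop).const_mul (S / r)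
      simpa using ENNReal.tendsto_ofReal h1
    exact tendsto_of_tendsto_of_tendsto_of_le_of_le tendsto_const_nhds hlim (fun n => zero_le)
      hbound
  obtain ⟨V, hV, hVlim⟩ := hmem _ (hq.closedBall_mem_absConvexNhds 0 one_pos)
  obtain ⟨m, r, hr, hmr⟩ := hq.exists_closedBall_subset hV.2
  have hpos' : 0 < ENNReal.ofReal (c m * r) := ENNReal.ofReal_pos.2 (mul_pos (hc0 m) hr)
  obtain ⟨n, hn, hmn⟩ := ((hVlim.eventually_lt_const hpos').and (eventually_ge_atTop m)).exists
  refine absurd hn (not_lt.2 ?_)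
  calc ENNReal.ofReal (c m * r)
      = ENNReal.ofReal (c m * Real.exp ((m : ℝ) * α n)) *
          ENNReal.ofReal (r * Real.exp (-((m : ℝ) * α n))) := by
        rw [← ENNReal.ofReal_mul (hterm m n), Real.exp_neg]
        congr 1
        have := Real.exp_pos ((m : ℝ) * α n)
        field_simp
    _ ≤ _ := by
        rw [Real.enorm_of_nonneg (hξ0 n)]
        refine mul_le_mul' (ENNReal.ofReal_le_ofReal ?_)
          (le_kolmogorovWidth_infinite hmono n m hr hmr)
        exact Finset.single_le_sum (fun i _ => hterm i n)
          (Finset.mem_range.2 (Nat.lt_succ_of_le hmn))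

end Infinite

/-! ### The second factor as a complemented subspace -/

section Complement

variable (X Y : Type) [AddCommGroup X] [Module ℂ X] [TopologicalSpace X]
  [AddCommGroup Y] [Module ℂ Y] [TopologicalSpace Y]

/-- The embedding of `Y` onto the subspace `{0} × Y` of `X × Y`. -/
def inrProdBot : Y →L[ℂ] (Submodule.prod ⊥ ⊤ : Submodule ℂ (X × Y)) :=
  (ContinuousLinearMap.inr ℂ X Y).codRestrict _ fun _ => ⟨rfl, trivial⟩

/-- `{0} × Y` is isomorphic to `Y`. -/
def prodBotEquiv : (Submodule.prod ⊥ ⊤ : Submodule ℂ (X × Y)) ≃L[ℂ] Y :=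
  ContinuousLinearEquiv.equivOfInverse
    ((ContinuousLinearMap.snd ℂ X Y).comp (Submodule.subtypeL _)) (inrProdBot X Y)
    (fun z => Subtype.ext (Prod.ext z.2.1.symm rfl)) (fun _ => rfl)

theorem closedComplemented_prod_bot_top :
    (Submodule.prod ⊥ ⊤ : Submodule ℂ (X × Y)).ClosedComplemented :=
  ⟨(inrProdBot X Y).comp (ContinuousLinearMap.snd ℂ X Y),
    fun z => Subtype.ext (Prod.ext z.2.1.symm rfl)⟩

end Complement

theorem mainTheorem7 (α : ℕ → ℝ) (hpos : ∀ n, 0 < α n) (hmono : Monotone α)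
    (htop : Tendsto α atTop atTop) (hstable : IsStableSequence α) :
    HasProminentSet (PowerSeriesSpaceFinite α hpos × PowerSeriesSpaceInfinite α hpos) ∧
    ¬ SatisfiesOmegaBar (PowerSeriesSpaceFinite α hpos × PowerSeriesSpaceInfinite α hpos) ∧
    (Submodule.prod ⊥ ⊤ : Submodule ℂ
      (PowerSeriesSpaceFinite α hpos × PowerSeriesSpaceInfinite α hpos)).ClosedComplemented ∧
    ¬ HasProminentSet (Submodule.prod ⊥ ⊤ : Submodule ℂ
      (PowerSeriesSpaceFinite α hpos × PowerSeriesSpaceInfinite α hpos)) := by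
  refine ⟨⟨_, isProminent_l1BallProdZero hmono hstable⟩, not_satisfiesOmegaBar_prod htop,
    closedComplemented_prod_bot_top _ _, fun h => ?_⟩
  exact not_hasProminentSet_infinite hmono htop (h.of_continuousLinearEquiv (prodBotEquiv _ _))
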